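/- Let $\kappa>0$ and $D_\kappa=\pi/\sqrt{\kappa}$. Let $(M,d)$ be a complete $\mathrm{CAT}(\kappa)$ space with $\operatorname{diam}(M)<D_\kappa/2$, and let $A,B\subseteq M$ be nonempty closed convex subsets with $A\cap B\neq\emptyset$. Here a subset $C\subseteq M$ is called convex if any two points of $C$ are joined by a geodesic of $M$ and every geodesic of $M$ joining two points of $C$ is contained in $C$. For a nonempty closed convex set $C\subseteq M$ let $P_C:M\to C$ denote the metric projection, i.e. $P_C(x)$ is the unique point of $C$ with $d(x,P_C(x))=d(x,C)=\inf_{c\in C}d(x,c)$. Let $x_0\in M$ be any starting point, and let $\{x_n\}$ be the sequence produced by the alternating projection method, $$x_{2n-1}=P_A(x_{2n-2}),\qquad x_{2n}=P_B(x_{2n-1}),\qquad n\in\mathbb{N},\ n\ge 1.$$ If $A$ or $B$ is locally compact (in the subspace topology), then $\{x_n\}$ converges in the metric $d$ to a point $x\in A\cap B$. -/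

import Mathlib

open Filter Topology

namespace CatKappa

/-- The number `D_κ = π / √κ` (used for `κ > 0`). -/
noncomputable def modelDiam (κ : ℝ) : ℝ := Real.pi / Real.sqrt κ

/-- `γ`, restricted to `[0, 1]`, is a geodesic from `x` to `y` for the distance function `d`. -/
def IsGeodesic {X : Type*} (d : X → X → ℝ) (γ : ℝ → X) (x y : X) : Prop :=
  γ 0 = x ∧ γ 1 = y ∧
    ∀ s ∈ Set.Icc (0 : ℝ) 1, ∀ t ∈ Set.Icc (0 : ℝ) 1, d (γ s) (γ t) = d x y * |s - t|

/-- The geodesic segment: the image of `[0, 1]` under the path `γ`. -/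
def segmentOf {X : Type*} (γ : ℝ → X) : Set X := γ '' Set.Icc (0 : ℝ) 1

/-- The unit sphere `𝕊²` in Euclidean `ℝ³`, the point set of the model space. -/
abbrev ModelSphere : Type := Metric.sphere (0 : EuclideanSpace ℝ (Fin 3)) 1

/-- The distance of the model space `M_κ²`: the angular distance on `𝕊²`
multiplied by `1 / √κ`. -/
noncomputable def modelDist (κ : ℝ) (u v : ModelSphere) : ℝ :=
  (1 / Real.sqrt κ) *
    Real.arccos (inner ℝ (u : EuclideanSpace ℝ (Fin 3)) (v : EuclideanSpace ℝ (Fin 3)))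

/-- A geodesic triangle for the distance `d`: three vertices, the side `γ i` being a geodesic
from `v i` to `v (i + 1)` (indices modulo 3). -/
def IsGeodesicTriangle {X : Type*} (d : X → X → ℝ) (v : Fin 3 → X) (γ : Fin 3 → ℝ → X) : Prop :=
  ∀ i, IsGeodesic d (γ i) (v i) (v (i + 1))

/-- The geodesic triangle `(v', γ')` of `M_κ²` is a comparison triangle for the triangle of `M`
with vertices `v`. -/
def IsComparisonTriangle {M : Type*} [MetricSpace M] (κ : ℝ) (v : Fin 3 → M)
    (v' : Fin 3 → ModelSphere) (γ' : Fin 3 → ℝ → ModelSphere) : Prop :=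
  IsGeodesicTriangle (modelDist κ) v' γ' ∧ ∀ i j, dist (v i) (v j) = modelDist κ (v' i) (v' j)

/-- The `CAT(κ)` inequality for the geodesic triangle `(v, γ)`: if `p`, `q` lie on the sides
`γ i`, `γ j` and `p'`, `q'` are comparison points for them on the corresponding sides of a
comparison triangle, then `d(p, q) ≤ ρ(p', q')`. -/
def SatisfiesCATInequality {M : Type*} [MetricSpace M] (κ : ℝ) (v : Fin 3 → M)
    (γ : Fin 3 → ℝ → M) : Prop :=
  ∀ (v' : Fin 3 → ModelSphere) (γ' : Fin 3 → ℝ → ModelSphere), IsComparisonTriangle κ v v' γ' →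
    ∀ (i j : Fin 3), ∀ p ∈ segmentOf (γ i), ∀ q ∈ segmentOf (γ j),
      ∀ p' ∈ segmentOf (γ' i), ∀ q' ∈ segmentOf (γ' j),
        dist p (v i) = modelDist κ p' (v' i) → dist q (v j) = modelDist κ q' (v' j) →
          dist p q ≤ modelDist κ p' q'

/-- `M` is a `CAT(κ)` space (for `κ > 0`): it is `D_κ`-geodesic and every geodesic triangle of
perimeter less than `2 D_κ` satisfies the `CAT(κ)` inequality. -/
def IsCAT (κ : ℝ) (M : Type*) [MetricSpace M] : Prop :=
  (∀ x y : M, dist x y < modelDiam κ → ∃ γ : ℝ → M, IsGeodesic dist γ x y) ∧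
  ∀ (v : Fin 3 → M) (γ : Fin 3 → ℝ → M), IsGeodesicTriangle dist v γ →
    dist (v 0) (v 1) + dist (v 1) (v 2) + dist (v 2) (v 0) < 2 * modelDiam κ →
      SatisfiesCATInequality κ v γ

/-- Convexity: any two points of `C` are joined by a geodesic of `M`, and every such geodesic
is contained in `C`. -/
def IsConvex {M : Type*} [MetricSpace M] (C : Set M) : Prop :=
  ∀ x ∈ C, ∀ y ∈ C, (∃ γ : ℝ → M, IsGeodesic dist γ x y) ∧
    ∀ γ : ℝ → M, IsGeodesic dist γ x y → segmentOf γ ⊆ C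

/-- `p` is a nearest point of `C` to `x`: `p ∈ C` and `d(x, p) = d(x, C)`. -/
def IsNearestPoint {M : Type*} [MetricSpace M] (C : Set M) (x p : M) : Prop :=
  p ∈ C ∧ dist x p = Metric.infDist x C

open Classical in
/-- The metric projection `P_C`, sending `x` to its nearest point in `C` (with the value `x`
if there is no nearest point; for a nonempty closed convex subset of a complete `CAT(κ)` space
of diameter less than `D_κ / 2` the nearest point exists and is unique). -/
noncomputable def metricProj {M : Type*} [MetricSpace M] (C : Set M) (x : M) : M :=
  if h : ∃ p, IsNearestPoint C x p then h.choose else x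

/-- `x` is the alternating projection sequence of `A`, `B` with starting point `x 0`:
`x_{2n-1} = P_A (x_{2n-2})` and `x_{2n} = P_B (x_{2n-1})` for `n ≥ 1`. -/
def IsAlternatingProjectionSeq {M : Type*} [MetricSpace M] (A B : Set M) (x : ℕ → M) : Prop :=
  ∀ n : ℕ, x (2 * n + 1) = metricProj A (x (2 * n)) ∧
    x (2 * n + 2) = metricProj B (x (2 * n + 1))

end CatKappa

namespace CatKappa

open Real

/-! ### The model sphere -/

/-! Projecting x to its nearest point p in a convex set satisfies a spherical Pythagorean
inequality: cos d(x,z) ≤ cos d(x,p) · cos d(p,z) for z in the set, distances scaled by √κ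
(`IsCAT.pythagoras`). It comes from comparison with the sphere via Stewart's inequality. For z ∈ A ∩
B it applies at every step, so d(x_n, z) decreases. Since the diameter bound keeps all cosines
positive, ratios of successive cosines tend to 1, which forces d(x_n, x_{n+1}) → 0. A closed convex
locally compact set is compact here, by a Hopf–Rinow argument and boundedness. Hence a subsequence
converges, and its limit lies in both sets because successive iterates merge. Monotonicity of the
distance to that limit upgrades this to convergence of the whole sequence. -/

theorem ModelSphere.inner_self (u : ModelSphere) :
    inner ℝ (u : EuclideanSpace ℝ (Fin 3)) (u : EuclideanSpace ℝ (Fin 3)) = 1 := by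
  rw [real_inner_self_eq_norm_sq, norm_eq_of_mem_sphere u, one_pow]

/-- Put v and w on the equator; the first two coordinates of u are then forced, and the triangle and
perimeter inequalities say exactly that they fit in the unit disc. -/
theorem exists_modelSphere_triangle {a b l : ℝ} (hl : 0 < l) (hlπ : l < π)
    (hb : 0 ≤ b) (h₁ : a ≤ b + l) (h₂ : b ≤ a + l) (h₃ : l ≤ a + b)
    (h₄ : a + b + l ≤ 2 * π) :
    ∃ u v w : ModelSphere,
      inner ℝ (u : EuclideanSpace ℝ (Fin 3)) (v : EuclideanSpace ℝ (Fin 3)) = cos a ∧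
      inner ℝ (u : EuclideanSpace ℝ (Fin 3)) (w : EuclideanSpace ℝ (Fin 3)) = cos b ∧
      inner ℝ (v : EuclideanSpace ℝ (Fin 3)) (w : EuclideanSpace ℝ (Fin 3)) = cos l := by
  have hs : 0 < sin l := sin_pos_of_pos_of_lt_pi hl hlπ
  have hlow : cos (a + l) ≤ cos b := by
    rcases le_total (a + l) π with h | h
    · exact cos_le_cos_of_nonneg_of_le_pi hb h h₂
    · rw [← cos_two_pi_sub (a + l)]
      exact cos_le_cos_of_nonneg_of_le_pi hb (by linarith) (by linarith)
  have hupp : cos b ≤ cos (a - l) := by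
    rw [← cos_abs (a - l)]
    refine cos_le_cos_of_nonneg_of_le_pi (abs_nonneg _) (by linarith) ?_
    rw [abs_le]; constructor <;> linarith
  rw [cos_add] at hlow
  rw [cos_sub] at hupp
  obtain ⟨s, hsdef⟩ : ∃ s, s * sin l = cos b - cos a * cos l :=
    ⟨(cos b - cos a * cos l) / sin l, by field_simp⟩
  have hs₁ : s ≤ sin a := by
    refine le_of_mul_le_mul_right ?_ hs
    linarith
  have hs₂ : -sin a ≤ s := by
    refine le_of_mul_le_mul_right ?_ hs
    linarith
  have hh : 0 ≤ 1 - cos a ^ 2 - s ^ 2 := by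
    have := sin_sq_add_cos_sq a
    nlinarith
  have hsq := sq_sqrt hh
  have hl2 := sin_sq_add_cos_sq l
  refine ⟨⟨!₂[cos a, s, √(1 - cos a ^ 2 - s ^ 2)], ?_⟩, ⟨!₂[1, 0, 0], ?_⟩,
    ⟨!₂[cos l, sin l, 0], ?_⟩, ?_, ?_, ?_⟩
  · rw [mem_sphere_zero_iff_norm, EuclideanSpace.norm_eq, sqrt_eq_one]
    simp [Fin.sum_univ_three]
    linarith
  · rw [mem_sphere_zero_iff_norm, EuclideanSpace.norm_eq, sqrt_eq_one]
    simp [Fin.sum_univ_three]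
  · rw [mem_sphere_zero_iff_norm, EuclideanSpace.norm_eq, sqrt_eq_one]
    simp [Fin.sum_univ_three]
  · simp [PiLp.inner_apply, Fin.sum_univ_three]
  · simp [PiLp.inner_apply, Fin.sum_univ_three]
    linarith
  · simp [PiLp.inner_apply, Fin.sum_univ_three]

theorem modelDist_eq {κ l : ℝ} {u v : ModelSphere} (hl : 0 ≤ l) (hlπ : l ≤ π)
    (h : inner ℝ (u : EuclideanSpace ℝ (Fin 3)) (v : EuclideanSpace ℝ (Fin 3)) = cos l) :
    modelDist κ u v = (1 / √κ) * l := by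
  rw [modelDist, h, arccos_cos hl hlπ]

theorem modelDist_self (κ : ℝ) (u : ModelSphere) : modelDist κ u u = 0 := by
  rw [modelDist, u.inner_self, arccos_one, mul_zero]

theorem modelDist_comm (κ : ℝ) (u v : ModelSphere) : modelDist κ u v = modelDist κ v u := by
  rw [modelDist, modelDist, real_inner_comm]

/-- Great circle arcs are geodesics of the model space. -/
theorem exists_modelSphere_geodesic (κ : ℝ) {l : ℝ} {u v : ModelSphere} (hl : 0 ≤ l) (hlπ : l < π)
    (h : inner ℝ (u : EuclideanSpace ℝ (Fin 3)) (v : EuclideanSpace ℝ (Fin 3)) = cos l) :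
    ∃ γ : ℝ → ModelSphere, IsGeodesic (modelDist κ) γ u v ∧
      ∀ (x : EuclideanSpace ℝ (Fin 3)) (t : ℝ),
        sin l * inner ℝ x (γ t : EuclideanSpace ℝ (Fin 3)) =
          sin ((1 - t) * l) * inner ℝ x (u : EuclideanSpace ℝ (Fin 3)) +
            sin (t * l) * inner ℝ x (v : EuclideanSpace ℝ (Fin 3)) := by
  -- The interpolation formula divides by sin l, so l = 0 is separate.
  rcases hl.eq_or_lt with rfl | hl'
  · have huv : u = v := by
      apply Subtype.ext
      rw [cos_zero] at h
      exact (inner_eq_one_iff_of_norm_eq_one (𝕜 := ℝ) (norm_eq_of_mem_sphere u)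
        (norm_eq_of_mem_sphere v)).1 h
    subst huv
    exact ⟨fun _ => u, ⟨rfl, rfl, fun s _ t _ => by simp [modelDist_self]⟩, by simp⟩
  have hs : 0 < sin l := sin_pos_of_pos_of_lt_pi hl' hlπ
  let f : ℝ → EuclideanSpace ℝ (Fin 3) := fun t =>
    (sin l)⁻¹ • (sin ((1 - t) * l) • (u : EuclideanSpace ℝ (Fin 3)) +
      sin (t * l) • (v : EuclideanSpace ℝ (Fin 3)))
  have hf : ∀ s t, inner ℝ (f s) (f t) = cos ((s - t) * l) := by
    intro s t
    have h' : inner ℝ (v : EuclideanSpace ℝ (Fin 3)) (u : EuclideanSpace ℝ (Fin 3)) = cos l := by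
      rw [real_inner_comm, h]
    simp only [f, inner_smul_left, inner_smul_right, inner_add_left, inner_add_right,
      u.inner_self, v.inner_self, h, h', sub_mul, one_mul, sin_sub, cos_sub, conj_trivial]
    have e := sin_sq_add_cos_sq l
    generalize sin (s * l) = p, sin (t * l) = q, cos (s * l) = p', cos (t * l) = q'
    field_simp
    linear_combination -(p * q) * e
  have hf1 : ∀ t, f t ∈ Metric.sphere (0 : EuclideanSpace ℝ (Fin 3)) 1 := by
    intro t
    have := hf t t
    rw [real_inner_self_eq_norm_sq, sub_self, zero_mul, cos_zero] at this
    rw [mem_sphere_zero_iff_norm]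
    exact (pow_eq_one_iff_of_nonneg (norm_nonneg _) two_ne_zero).1 this
  refine ⟨fun t => ⟨f t, hf1 t⟩, ⟨?_, ?_, ?_⟩, ?_⟩
  · apply Subtype.ext
    simp [f, smul_smul, hs.ne']
  · apply Subtype.ext
    simp [f, smul_smul, hs.ne']
  · intro s hs' t ht
    have h1 : |s - t| ≤ 1 := by
      rw [abs_le]; constructor <;> linarith [hs'.1, hs'.2, ht.1, ht.2]
    rw [modelDist_eq (l := |s - t| * l) (by positivity) (by nlinarith), modelDist_eq hl hlπ.le h]
    · ring
    · rw [hf, ← cos_abs, abs_mul, abs_of_pos hl']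
  · intro x t
    simp only [f, inner_smul_right, inner_add_right]
    field_simp

/-! ### Geometry of `CAT(κ)` spaces of small diameter -/

section CAT

variable {M : Type*} [MetricSpace M] {κ : ℝ}

theorem mul_dist_lt_pi_div_two (hκ : 0 < κ)
    (hdiam : Metric.ediam (Set.univ : Set M) < ENNReal.ofReal (modelDiam κ / 2)) (x y : M) :
    √κ * dist x y < π / 2 := by
  have hk : 0 < √κ := sqrt_pos.2 hκ
  have h := (Metric.edist_le_ediam_of_mem (Set.mem_univ x) (Set.mem_univ y)).trans_lt hdiam
  rw [edist_dist, ENNReal.ofReal_lt_ofReal_iff_of_nonneg dist_nonneg, modelDiam] at h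
  have h2 := mul_lt_mul_of_pos_left h hk
  have e : √κ * (π / √κ / 2) = π / 2 := by field_simp
  rwa [e] at h2

theorem IsCAT.exists_geodesic (hκ : 0 < κ) (hM : IsCAT κ M)
    (hd : ∀ x y : M, √κ * dist x y < π / 2) (x y : M) : ∃ γ : ℝ → M, IsGeodesic dist γ x y := by
  refine hM.1 x y ?_
  rw [modelDiam, lt_div_iff₀ (sqrt_pos.2 hκ), mul_comm]
  linarith [hd x y, pi_pos]

/-- The spherical Stewart inequality. -/
theorem IsCAT.stewart (hκ : 0 < κ) (hM : IsCAT κ M)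
    (hd : ∀ x y : M, √κ * dist x y < π / 2) (x : M) {y z : M} (hyz : y ≠ z) {γ : ℝ → M}
    (hγ : IsGeodesic dist γ y z) {t : ℝ} (ht : t ∈ Set.Icc (0 : ℝ) 1) :
    sin ((1 - t) * (√κ * dist y z)) * cos (√κ * dist x y) +
      sin (t * (√κ * dist y z)) * cos (√κ * dist x z) ≤
        sin (√κ * dist y z) * cos (√κ * dist x (γ t)) := by
  have hk : 0 < √κ := sqrt_pos.2 hκ
  have hk0 : √κ ≠ 0 := hk.ne'
  have hπ := pi_pos
  have hl : 0 < √κ * dist y z := mul_pos hk (dist_pos.2 hyz)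
  have ha : 0 ≤ √κ * dist x y := by positivity
  have hb : 0 ≤ √κ * dist x z := by positivity
  have da := hd x y
  have db := hd x z
  have dl := hd y z
  obtain ⟨u, v, w, huv, huw, hvw⟩ := exists_modelSphere_triangle (a := √κ * dist x y) hl
    (by linarith) hb
    (by rw [← mul_add]; exact mul_le_mul_of_nonneg_left
          (by rw [dist_comm y z]; exact dist_triangle x z y) hk.le)
    (by rw [← mul_add]; exact mul_le_mul_of_nonneg_left (dist_triangle x y z) hk.le)
    (by rw [← mul_add]; exact mul_le_mul_of_nonneg_left
          (by rw [dist_comm x y]; exact dist_triangle y x z) hk.le)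
    (by linarith)
  have hwu : inner ℝ (w : EuclideanSpace ℝ (Fin 3)) (u : EuclideanSpace ℝ (Fin 3)) =
      cos (√κ * dist x z) := by rw [real_inner_comm, huw]
  obtain ⟨δ₀, hδ₀, -⟩ := exists_modelSphere_geodesic κ ha (by linarith) huv
  obtain ⟨δ₁, hδ₁, hδ⟩ := exists_modelSphere_geodesic κ hl.le (by linarith) hvw
  obtain ⟨δ₂, hδ₂, -⟩ := exists_modelSphere_geodesic κ hb (by linarith) hwu
  obtain ⟨γ₀, hγ₀⟩ := hM.exists_geodesic hκ hd x y
  obtain ⟨γ₂, hγ₂⟩ := hM.exists_geodesic hκ hd z x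
  have muv : modelDist κ u v = dist x y := by
    rw [modelDist_eq ha (by linarith) huv]; field_simp
  have muw : modelDist κ u w = dist x z := by
    rw [modelDist_eq hb (by linarith) huw]; field_simp
  have mvw : modelDist κ v w = dist y z := by
    rw [modelDist_eq hl.le (by linarith) hvw]; field_simp
  -- Compare the vertex x, on side 0, with `γ t`, on side 1. On the sphere Stewart's relation is the
  -- equality `hδ u t`.
  have key := hM.2 ![x, y, z] ![γ₀, γ, γ₂]
    (by intro i; fin_cases i <;> simpa) (by
      have : √κ * (dist x y + dist y z + dist z x) < √κ * (2 * modelDiam κ) := by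
        rw [modelDiam, dist_comm z x]
        have e : √κ * (2 * (π / √κ)) = 2 * π := by field_simp
        rw [e]; linarith
      exact lt_of_mul_lt_mul_left this hk.le)
    ![u, v, w] ![δ₀, δ₁, δ₂]
    ⟨by intro i; fin_cases i <;> simpa, by
      intro i j
      fin_cases i <;> fin_cases j <;>
        simp [modelDist_self, muv, muw, mvw, modelDist_comm κ v u, modelDist_comm κ w u,
          modelDist_comm κ w v, dist_comm]⟩
    0 1 x ⟨0, by simp, hγ₀.1⟩ (γ t) ⟨t, ht, rfl⟩ u ⟨0, by simp, hδ₀.1⟩ (δ₁ t) ⟨t, ht, rfl⟩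
    (by simp [modelDist_self])
    (by
      have h1 := hγ.2.2 t ht 0 (by simp)
      have h2 := hδ₁.2.2 t ht 0 (by simp)
      rw [hγ.1] at h1
      rw [hδ₁.1, mvw] at h2
      simp [h1, h2])
  have h3 : √κ * dist x (γ t) ≤
      arccos (inner ℝ (u : EuclideanSpace ℝ (Fin 3)) (δ₁ t : EuclideanSpace ℝ (Fin 3))) := by
    have := mul_le_mul_of_nonneg_left key hk.le
    rw [modelDist, ← mul_assoc, mul_one_div_cancel hk0, one_mul] at this
    exact this
  have h4 := cos_le_cos_of_nonneg_of_le_pi (by positivity) (arccos_le_pi _) h3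
  have habs := abs_real_inner_le_norm (u : EuclideanSpace ℝ (Fin 3))
    (δ₁ t : EuclideanSpace ℝ (Fin 3))
  rw [norm_eq_of_mem_sphere, norm_eq_of_mem_sphere, one_mul, abs_le] at habs
  rw [cos_arccos habs.1 habs.2] at h4
  have h5 := hδ u t
  rw [huv, huw] at h5
  rw [← h5]
  exact mul_le_mul_of_nonneg_left h4 (sin_pos_of_pos_of_lt_pi hl (by linarith)).le

/-- The spherical median inequality. -/
theorem IsCAT.median (hκ : 0 < κ) (hM : IsCAT κ M)
    (hd : ∀ x y : M, √κ * dist x y < π / 2) (x : M) {y z : M} {γ : ℝ → M}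
    (hγ : IsGeodesic dist γ y z) :
    cos (√κ * dist x y) + cos (√κ * dist x z) ≤
      2 * cos (√κ * dist y z / 2) * cos (√κ * dist x (γ (1 / 2))) := by
  rcases eq_or_ne y z with rfl | hyz
  · have h := hγ.2.2 0 (by simp) (1 / 2) (by norm_num)
    rw [hγ.1, dist_self, zero_mul, dist_eq_zero] at h
    rw [← h]
    simp
    linarith
  have h := hM.stewart hκ hd x hyz hγ (t := 1 / 2) (by norm_num)
  have hl : 0 < √κ * dist y z := mul_pos (sqrt_pos.2 hκ) (dist_pos.2 hyz)
  have hs : 0 < sin (√κ * dist y z / 2) :=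
    sin_pos_of_pos_of_lt_pi (by linarith) (by linarith [hd y z, pi_pos])
  have e1 : (1 - 1 / 2) * (√κ * dist y z) = √κ * dist y z / 2 := by ring
  have e2 : 1 / 2 * (√κ * dist y z) = √κ * dist y z / 2 := by ring
  have e3 : sin (√κ * dist y z) = 2 * sin (√κ * dist y z / 2) * cos (√κ * dist y z / 2) := by
    rw [← sin_two_mul]; ring_nf
  rw [e1, e2, e3] at h
  refine le_of_mul_le_mul_left ?_ hs
  linarith

theorem cos_mul_dist_pos (hd : ∀ x y : M, √κ * dist x y < π / 2) (x y : M) :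
    0 < cos (√κ * dist x y) :=
  cos_pos_of_mem_Ioo ⟨by
    have : 0 ≤ √κ * dist x y := by positivity
    linarith [pi_pos], hd x y⟩

theorem cos_mul_dist_le_iff (hκ : 0 < κ) (hd : ∀ x y : M, √κ * dist x y < π / 2) (x y z w : M) :
    cos (√κ * dist x y) ≤ cos (√κ * dist z w) ↔ dist z w ≤ dist x y := by
  have hk : 0 < √κ := sqrt_pos.2 hκ
  have hπ := pi_pos
  rw [strictAntiOn_cos.le_iff_ge ⟨by positivity, by linarith [hd x y]⟩
    ⟨by positivity, by linarith [hd z w]⟩, mul_le_mul_iff_right₀ hk]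

/-- The Pythagorean inequality at a nearest point of a convex set. -/
theorem IsCAT.pythagoras (hκ : 0 < κ) (hM : IsCAT κ M)
    (hd : ∀ x y : M, √κ * dist x y < π / 2) {C : Set M} (hC : IsConvex C) {x p z : M}
    (hp : IsNearestPoint C x p) (hz : z ∈ C) :
    cos (√κ * dist x z) ≤ cos (√κ * dist x p) * cos (√κ * dist p z) := by
  rcases eq_or_ne p z with rfl | hpz
  · simp
  obtain ⟨⟨γ, hγ⟩, hγC⟩ := hC p hp.1 z hz
  set l := √κ * dist p z with hldef
  have hl : 0 < l := mul_pos (sqrt_pos.2 hκ) (dist_pos.2 hpz)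
  have hlπ : l < π / 2 := hd p z
  -- First variation: `γ t` is no closer to x than p. Stewart's inequality divided by 2 sin(tl/2)
  -- survives the limit t → 0, where it becomes the claim.
  have key : ∀ t ∈ Set.Ioc (0 : ℝ) 1, cos (t * l / 2) * cos (√κ * dist x z) ≤
      cos (√κ * dist x p) * cos (l - t * l / 2) := by
    intro t ht
    have ht' : t ∈ Set.Icc (0 : ℝ) 1 := ⟨ht.1.le, ht.2⟩
    have h := hM.stewart hκ hd x hpz hγ ht'
    have hle : cos (√κ * dist x (γ t)) ≤ cos (√κ * dist x p) := by
      rw [cos_mul_dist_le_iff hκ hd, hp.2]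
      exact Metric.infDist_le_dist_of_mem (hγC γ hγ ⟨t, ht', rfl⟩)
    have hsl : 0 ≤ sin l := sin_nonneg_of_nonneg_of_le_pi hl.le (by linarith [pi_pos])
    have h' := h.trans (mul_le_mul_of_nonneg_left hle hsl)
    have htl : 0 < t * l := mul_pos ht.1 hl
    have htl' : t * l ≤ l := by nlinarith [ht.2]
    have hs : 0 < sin (t * l / 2) :=
      sin_pos_of_pos_of_lt_pi (by linarith) (by linarith [pi_pos])
    have e1 : sin (t * l) = 2 * sin (t * l / 2) * cos (t * l / 2) := by
      rw [← sin_two_mul]; ring_nf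
    have e2 : sin l - sin ((1 - t) * l) = 2 * sin (t * l / 2) * cos (l - t * l / 2) := by
      rw [sin_sub_sin]; ring_nf
    rw [← hldef, e1] at h'
    refine le_of_mul_le_mul_left ?_ hs
    linear_combination (h' + e2 * cos (√κ * dist x p)) / 2
  have hc : Continuous fun t : ℝ => cos (t * l / 2) * cos (√κ * dist x z) := by fun_prop
  have hc' : Continuous fun t : ℝ => cos (√κ * dist x p) * cos (l - t * l / 2) := by fun_prop
  have := le_of_tendsto_of_tendsto ((hc.tendsto 0).mono_left nhdsWithin_le_nhds)
    ((hc'.tendsto 0).mono_left nhdsWithin_le_nhds)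
    (Filter.mem_of_superset (Ioc_mem_nhdsGT (zero_lt_one' ℝ)) key)
  simpa using this

/-- A minimizing sequence is Cauchy: midpoints stay in C, so they cannot beat the infimum, while the
median inequality would make them do so if two terms stayed far apart. -/
theorem IsCAT.exists_isNearestPoint [CompleteSpace M] (hκ : 0 < κ) (hM : IsCAT κ M)
    (hd : ∀ x y : M, √κ * dist x y < π / 2) {C : Set M} (hne : C.Nonempty) (hcl : IsClosed C)
    (hC : IsConvex C) (x : M) : ∃ p, IsNearestPoint C x p := by
  have hk : 0 < √κ := sqrt_pos.2 hκ
  set r := Metric.infDist x C with hr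
  have hr0 : 0 ≤ r := Metric.infDist_nonneg
  have hrπ : √κ * r < π / 2 := by
    obtain ⟨c, hc⟩ := hne
    exact (mul_le_mul_of_nonneg_left (Metric.infDist_le_dist_of_mem hc) hk.le).trans_lt (hd x c)
  have hD : 0 < cos (√κ * r) := by
    refine cos_pos_of_mem_Ioo ⟨?_, hrπ⟩
    have : 0 ≤ √κ * r := by positivity
    linarith [pi_pos]
  have hseq : ∀ n : ℕ, ∃ c ∈ C, dist x c < r + 1 / ((n : ℝ) + 1) := fun n =>
    (Metric.infDist_lt_iff hne).1 (lt_add_of_pos_right _ (by positivity))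
  choose c hcC hc using hseq
  have hlim : Tendsto (fun n => dist x (c n)) atTop (𝓝 r) := by
    refine tendsto_of_tendsto_of_tendsto_of_le_of_le tendsto_const_nhds
      (h := fun n : ℕ => r + 1 / ((n : ℝ) + 1)) ?_
      (fun n => Metric.infDist_le_dist_of_mem (hcC n)) (fun n => (hc n).le)
    simpa using tendsto_const_nhds.add (tendsto_one_div_add_atTop_nhds_zero_nat (𝕜 := ℝ))
  have hcos : Tendsto (fun n => cos (√κ * dist x (c n))) atTop (𝓝 (cos (√κ * r))) :=
    (continuous_cos.tendsto _).comp (hlim.const_mul _)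
  have hcauchy : CauchySeq c := by
    rw [Metric.cauchySeq_iff']
    intro ε hε
    -- Half of ε, rescaled; the cap at π/2 keeps cos θ nonnegative.
    set θ := min (√κ * ε / 2) (π / 2) with hθ
    have hθ0 : 0 < θ := lt_min (by positivity) (by positivity)
    have hcθ : cos θ < 1 := by
      rw [← cos_zero]
      exact cos_lt_cos_of_nonneg_of_le_pi_div_two le_rfl (min_le_right _ _) hθ0
    obtain ⟨N, hN⟩ := eventually_atTop.1
      (hcos.eventually (lt_mem_nhds (show cos θ * cos (√κ * r) < cos (√κ * r) by nlinarith)))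
    refine ⟨N, fun n hn => ?_⟩
    by_contra! hge
    obtain ⟨⟨γ, hγ⟩, hγC⟩ := hC _ (hcC n) _ (hcC N)
    have hm := hM.median hκ hd x hγ
    have h1 : cos (√κ * dist x (γ (1 / 2))) ≤ cos (√κ * r) := by
      refine cos_le_cos_of_nonneg_of_le_pi (by positivity) (by linarith [hd x (γ (1/2)), pi_pos])
        (mul_le_mul_of_nonneg_left ?_ hk.le)
      exact Metric.infDist_le_dist_of_mem (hγC γ hγ ⟨1 / 2, by norm_num, rfl⟩)
    have h2 : cos (√κ * dist (c n) (c N) / 2) ≤ cos θ := by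
      refine cos_le_cos_of_nonneg_of_le_pi hθ0.le (by linarith [hd (c n) (c N), pi_pos]) ?_
      refine (min_le_left _ _).trans ?_
      have := mul_le_mul_of_nonneg_left hge hk.le
      linarith
    have h3 : cos (√κ * dist (c n) (c N) / 2) * cos (√κ * dist x (γ (1 / 2))) ≤
        cos θ * cos (√κ * r) := by
      have hpos := cos_mul_dist_pos hd x (γ (1 / 2))
      have hθc : 0 ≤ cos θ :=
        cos_nonneg_of_mem_Icc ⟨by linarith [pi_pos], min_le_right _ _⟩
      exact mul_le_mul h2 h1 hpos.le hθc
    linarith [hN n hn, hN N le_rfl]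
  obtain ⟨p, hp⟩ := cauchySeq_tendsto_of_complete hcauchy
  exact ⟨p, hcl.mem_of_tendsto hp (Eventually.of_forall hcC),
    tendsto_nhds_unique (tendsto_const_nhds.dist hp) hlim⟩

theorem isNearestPoint_metricProj {C : Set M} {x : M} (h : ∃ p, IsNearestPoint C x p) :
    IsNearestPoint C x (metricProj C x) := by
  rw [metricProj, dif_pos h]
  exact h.choose_spec

end CAT

/-! ### The Hopf–Rinow theorem -/

/-- Continuous induction on the radius. `hgeo` is all that is needed of geodesics: a point at radius
r on the way to y. -/
theorem isCompact_closedBall_of_locallyCompact {Y : Type*} [MetricSpace Y] [CompleteSpace Y]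
    [LocallyCompactSpace Y] (a : Y)
    (hgeo : ∀ y : Y, ∀ r : ℝ, 0 ≤ r → r ≤ dist a y →
      ∃ z, dist a z ≤ r ∧ dist z y ≤ dist a y - r) {D : ℝ} (hD : 0 ≤ D) :
    IsCompact (Metric.closedBall a D) := by
  let S : Set ℝ := {r | IsCompact (Metric.closedBall a r)}
  suffices h : Set.Icc 0 D ⊆ S from h ⟨hD, le_rfl⟩
  have hmono : ∀ {r R : ℝ}, r ≤ R → R ∈ S → r ∈ S := fun hrR hR =>
    IsCompact.of_isClosed_subset hR Metric.isClosed_closedBall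
      (Metric.closedBall_subset_closedBall hrR)
  have h0 : (0 : ℝ) ∈ S := by simp [S]
  refine IsClosed.Icc_subset_of_forall_exists_gt ?_ h0 ?_
  -- Closedness: the R-ball lies within ε/2 of a compact r-ball, so it is totally bounded.
  · refine isClosed_of_closure_subset fun R hR => ?_
    have hRI : R ∈ Set.Icc 0 D :=
      closure_minimal Set.inter_subset_right isClosed_Icc hR
    refine ⟨?_, hRI⟩
    refine isCompact_iff_totallyBounded_isComplete.2 ⟨?_, Metric.isClosed_closedBall.isComplete⟩
    rw [Metric.totallyBounded_iff]
    intro ε hε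
    obtain ⟨r, ⟨hrS, hrI⟩, hr⟩ := Metric.mem_closure_iff.1 hR (ε / 2) (half_pos hε)
    rw [Real.dist_eq, abs_lt] at hr
    obtain ⟨T, hT, hcov⟩ := Metric.totallyBounded_iff.1 (IsCompact.totallyBounded hrS) (ε / 2)
      (half_pos hε)
    refine ⟨T, hT, fun y hy => ?_⟩
    rw [Metric.mem_closedBall, dist_comm] at hy
    obtain ⟨z, hz, hzy⟩ : ∃ z, dist a z ≤ r ∧ dist z y < ε / 2 := by
      rcases le_total (dist a y) r with h | h
      · exact ⟨y, h, by simpa using hε⟩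
      · obtain ⟨z, h1, h2⟩ := hgeo y r hrI.1 h
        exact ⟨z, h1, by linarith⟩
    have := hcov (show z ∈ Metric.closedBall a r by rwa [Metric.mem_closedBall, dist_comm])
    simp only [Set.mem_iUnion, Metric.mem_ball, exists_prop] at this ⊢
    obtain ⟨w, hw, hzw⟩ := this
    refine ⟨w, hw, ?_⟩
    linarith [dist_triangle y z w, dist_comm y z]
  -- Openness to the right: a compact neighbourhood of the r-ball contains the (r + δ)-ball.
  · rintro r ⟨hrS, hrI⟩ R hR
    obtain ⟨K, hK, hsub⟩ := exists_compact_superset hrS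
    obtain ⟨δ, hδ, hδK⟩ := IsCompact.exists_cthickening_subset_open hrS isOpen_interior hsub
    have hrδ : r + δ ∈ S := by
      refine hK.of_isClosed_subset Metric.isClosed_closedBall fun y hy => ?_
      refine interior_subset (hδK ?_)
      rw [Metric.mem_closedBall, dist_comm] at hy
      obtain ⟨z, hz, hzy⟩ : ∃ z, dist a z ≤ r ∧ dist z y ≤ δ := by
        rcases le_total (dist a y) r with h | h
        · exact ⟨y, h, by simpa using hδ.le⟩
        · obtain ⟨z, h1, h2⟩ := hgeo y r hrI.1 h
          exact ⟨z, h1, by linarith⟩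
      exact Metric.mem_cthickening_of_dist_le y z δ _ (by rwa [Metric.mem_closedBall, dist_comm])
        (by rwa [dist_comm])
    exact ⟨min R (r + δ), hmono (min_le_right _ _) hrδ,
      lt_min hR (by linarith), min_le_left _ _⟩

/-- Convexity keeps geodesics inside C, and boundedness makes C one of its own closed balls. -/
theorem IsConvex.isCompact {M : Type*} [MetricSpace M] [CompleteSpace M] {C : Set M}
    (hC : IsConvex C) (hcl : IsClosed C) [LocallyCompactSpace C] {D : ℝ}
    (hD : ∀ x y : M, dist x y ≤ D) : IsCompact C := by
  rcases C.eq_empty_or_nonempty with rfl | ⟨a, ha⟩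
  · exact isCompact_empty
  have : CompleteSpace C := hcl.completeSpace_coe
  have hball := isCompact_closedBall_of_locallyCompact (⟨a, ha⟩ : C) (D := D) (by
    rintro ⟨y, hy⟩ r hr hry
    rw [Subtype.dist_eq] at hry
    obtain ⟨⟨γ, hγ⟩, hγC⟩ := hC a ha y hy
    rcases hr.eq_or_lt with rfl | hr'
    · exact ⟨⟨a, ha⟩, by simp, by simp⟩
    have hpos : 0 < dist a y := hr'.trans_le hry
    have ht : r / dist a y ∈ Set.Icc (0 : ℝ) 1 := ⟨by positivity, (div_le_one hpos).2 hry⟩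
    refine ⟨⟨γ (r / dist a y), hγC γ hγ ⟨_, ht, rfl⟩⟩, ?_, ?_⟩
    · have h := hγ.2.2 0 (by simp) _ ht
      rw [hγ.1, zero_sub, abs_neg, abs_of_nonneg ht.1, mul_div_cancel₀ _ hpos.ne'] at h
      exact h.le
    · have h := hγ.2.2 _ ht 1 (by simp)
      rw [hγ.2.1, abs_of_nonpos (by linarith [ht.2]), mul_neg, mul_sub,
        mul_div_cancel₀ _ hpos.ne'] at h
      rw [Subtype.dist_eq, Subtype.dist_eq, h]
      simp) ((dist_self a).symm.le.trans (hD a a))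
  have huniv : Metric.closedBall (⟨a, ha⟩ : C) D = Set.univ :=
    Set.eq_univ_of_forall fun y => hD _ _
  rw [huniv] at hball
  exact isCompact_iff_isCompact_univ.2 hball

/-! ### Alternating projections -/

section AlternatingProjection

variable {M : Type*} [MetricSpace M] {κ : ℝ} {x : ℕ → M} {z : M}

/-- Fejér monotonicity: drop the factor cos ≤ 1. -/
theorem antitone_dist_of_cos_le (hκ : 0 < κ) (hd : ∀ x y : M, √κ * dist x y < π / 2)
    (h : ∀ n, cos (√κ * dist (x n) z) ≤
      cos (√κ * dist (x n) (x (n + 1))) * cos (√κ * dist (x (n + 1)) z)) :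
    Antitone fun n => dist (x n) z := by
  refine antitone_nat_of_succ_le fun n => ?_
  rw [← cos_mul_dist_le_iff hκ hd]
  refine (h n).trans (mul_le_of_le_one_left (cos_mul_dist_pos hd _ _).le (cos_le_one _))

/-- Asymptotic regularity. -/
theorem tendsto_dist_succ_of_cos_le (hκ : 0 < κ) (hd : ∀ x y : M, √κ * dist x y < π / 2)
    (h : ∀ n, cos (√κ * dist (x n) z) ≤
      cos (√κ * dist (x n) (x (n + 1))) * cos (√κ * dist (x (n + 1)) z)) :
    Tendsto (fun n => dist (x n) (x (n + 1))) atTop (𝓝 0) := by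
  have hk : 0 < √κ := sqrt_pos.2 hκ
  have hmono : Monotone fun n => cos (√κ * dist (x n) z) := by
    intro m n hmn
    rw [cos_mul_dist_le_iff hκ hd]
    exact antitone_dist_of_cos_le hκ hd h hmn
  obtain ⟨L, hL⟩ : ∃ L, Tendsto (fun n => cos (√κ * dist (x n) z)) atTop (𝓝 L) :=
    ⟨_, tendsto_atTop_ciSup hmono ⟨1, by rintro _ ⟨n, rfl⟩; exact cos_le_one _⟩⟩
  have hL0 : 0 < L := (cos_mul_dist_pos hd (x 0) z).trans_le (hmono.ge_of_tendsto hL 0)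
  have hdiv : Tendsto (fun n => cos (√κ * dist (x n) z) / cos (√κ * dist (x (n + 1)) z)) atTop
      (𝓝 1) := by
    have := hL.div (hL.comp (tendsto_add_atTop_nat 1)) hL0.ne'
    rw [div_self hL0.ne'] at this
    exact this
  have hcos : Tendsto (fun n => cos (√κ * dist (x n) (x (n + 1)))) atTop (𝓝 1) :=
    tendsto_of_tendsto_of_tendsto_of_le_of_le hdiv tendsto_const_nhds
      (fun n => (div_le_iff₀ (cos_mul_dist_pos hd _ _)).2 (h n)) (fun n => cos_le_one _)
  have harc := (continuous_arccos.tendsto 1).comp hcos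
  rw [arccos_one] at harc
  have := harc.const_mul (√κ)⁻¹
  rw [mul_zero] at this
  refine this.congr fun n => ?_
  have hn : 0 ≤ √κ * dist (x n) (x (n + 1)) := by positivity
  rw [Function.comp_apply, arccos_cos hn (by linarith [hd (x n) (x (n + 1)), pi_pos]),
    inv_mul_cancel_left₀ hk.ne']

end AlternatingProjection

end CatKappa

open CatKappa in
theorem mainTheorem4 {M : Type*} [MetricSpace M] [CompleteSpace M] (κ : ℝ) (hκ : 0 < κ)
    (hM : CatKappa.IsCAT κ M)
    (hdiam : Metric.ediam (Set.univ : Set M) < ENNReal.ofReal (CatKappa.modelDiam κ / 2))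
    (A B : Set M) (hAne : A.Nonempty) (hBne : B.Nonempty)
    (hAconv : CatKappa.IsConvex A) (hBconv : CatKappa.IsConvex B)
    (hAcl : IsClosed A) (hBcl : IsClosed B) (hAB : (A ∩ B).Nonempty)
    (x₀ : M) (x : ℕ → M) (hx₀ : x 0 = x₀) (hx : CatKappa.IsAlternatingProjectionSeq A B x)
    (hloc : LocallyCompactSpace A ∨ LocallyCompactSpace B) :
    ∃ p ∈ A ∩ B, Tendsto x atTop (𝓝 p) := by
  have hd : ∀ x y : M, √κ * dist x y < Real.pi / 2 := mul_dist_lt_pi_div_two hκ hdiam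
  have hbdd : ∀ x y : M, dist x y ≤ Real.pi / 2 / √κ := fun x y => by
    rw [le_div_iff₀ (Real.sqrt_pos.2 hκ), mul_comm]
    exact (hd x y).le
  have hodd : ∀ n, IsNearestPoint A (x (2 * n)) (x (2 * n + 1)) := fun n => by
    rw [(hx n).1]
    exact isNearestPoint_metricProj (hM.exists_isNearestPoint hκ hd hAne hAcl hAconv _)
  have heven : ∀ n, IsNearestPoint B (x (2 * n + 1)) (x (2 * n + 2)) := fun n => by
    rw [(hx n).2]
    exact isNearestPoint_metricProj (hM.exists_isNearestPoint hκ hd hBne hBcl hBconv _)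
  have hpyth : ∀ z ∈ A ∩ B, ∀ n, Real.cos (√κ * dist (x n) z) ≤
      Real.cos (√κ * dist (x n) (x (n + 1))) * Real.cos (√κ * dist (x (n + 1)) z) := by
    intro z hz n
    obtain ⟨m, rfl | rfl⟩ := n.even_or_odd'
    · exact hM.pythagoras hκ hd hAconv (hodd m) hz.1
    · exact hM.pythagoras hκ hd hBconv (heven m) hz.2
  have hreg : Tendsto (fun n => dist (x n) (x (n + 1))) atTop (𝓝 0) := by
    obtain ⟨z, hz⟩ := hAB
    exact tendsto_dist_succ_of_cos_le hκ hd (hpyth z hz)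
  have hsucc : ∀ {φ : ℕ → ℕ} {p : M}, Tendsto φ atTop atTop →
      Tendsto (fun n => x (φ n)) atTop (𝓝 p) → Tendsto (fun n => x (φ n + 1)) atTop (𝓝 p) :=
    fun hφ hp => (tendsto_iff_of_dist (hreg.comp hφ)).1 hp
  obtain ⟨p, hpAB, φ, hφ, hp⟩ : ∃ p ∈ A ∩ B, ∃ φ : ℕ → ℕ, Tendsto φ atTop atTop ∧
      Tendsto (fun n => x (φ n)) atTop (𝓝 p) := by
    rcases hloc with hA | hB
    · obtain ⟨p, hpA, ψ, hψ, hp⟩ :=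
        (hAconv.isCompact hAcl hbdd).tendsto_subseq fun n => (hodd n).1
      have hφ : Tendsto (fun n => 2 * ψ n + 1) atTop atTop :=
        tendsto_atTop_mono (fun n => by omega) hψ.tendsto_atTop
      exact ⟨p, ⟨hpA, hBcl.mem_of_tendsto (hsucc hφ hp)
        (Eventually.of_forall fun n => (heven (ψ n)).1)⟩, _, hφ, hp⟩
    · obtain ⟨p, hpB, ψ, hψ, hp⟩ :=
        (hBconv.isCompact hBcl hbdd).tendsto_subseq fun n => (heven n).1
      have hφ : Tendsto (fun n => 2 * ψ n + 2) atTop atTop :=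
        tendsto_atTop_mono (fun n => by omega) hψ.tendsto_atTop
      -- The successor index 2ψ(n) + 3 is 2(ψ(n) + 1) + 1, hence the shift.
      exact ⟨p, ⟨hAcl.mem_of_tendsto (hsucc hφ hp)
        (Eventually.of_forall fun n => (hodd (ψ n + 1)).1), hpB⟩, _, hφ, hp⟩
  refine ⟨p, hpAB, tendsto_iff_dist_tendsto_zero.2 ?_⟩
  -- Fejér monotonicity at z = p: the distances to p decrease and vanish along a subsequence, so
  -- they tend to 0.
  have hanti := antitone_dist_of_cos_le hκ hd (hpyth p hpAB)
  have hlim := tendsto_atTop_ciInf hanti ⟨0, by rintro _ ⟨n, rfl⟩; exact dist_nonneg⟩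
  rwa [tendsto_nhds_unique (hlim.comp hφ) (tendsto_iff_dist_tendsto_zero.1 hp)] at hlim
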